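/- A seller offers two items to one buyer whose valuation $z=(z_1,z_2)$ is uniformly distributed on the rectangle $D=[c_1,c_1+b_1]\times[c_2,c_2+b_2]$. A (direct, unit-demand) mechanism consists of an allocation $q=(q_1,q_2):D\to\{(x_1,x_2): x_1,x_2\ge 0,\ x_1+x_2\le 1\}$ and a payment $t:D\to[0,\infty)$. It is incentive compatible if $z\cdot q(z)-t(z)\ge z\cdot q(w)-t(w)$ for all $z,w\in D$, and individually rational if $z\cdot q(z)-t(z)\ge 0$ for all $z\in D$. It is optimal if it maximizes the expected payment $\mathbb E[t(z)]$ among all incentive compatible and individually rational unit-demand mechanisms. Let $b_1\ge b_2>0$, $c_1\ge c_2\ge 0$ and $2c_1-c_2\le b_2$, and put $d=c_1-c_2$. Then the system \[ -3\delta_1\delta_2-c_2\delta_1-c_1\delta_2+b_1b_2=0, \] \[ -\tfrac32\delta_2^2+2b_2\delta_2-\tfrac{b_2^2}{2}-d(b_2-\delta_2)+(c_2-2b_2+3\delta_2)\delta_1=0 \] has a solution $(\delta_1,\delta_2)$ with $0<\delta_1<b_1$ and $0<\delta_2<b_2$. For every such solution, $\delta_1-\delta_2\le b_1-b_2$, and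 the posted-price mechanism with price $c_1+\delta_1$ for item $1$ and price $c_2+\delta_2$ for item $2$ is optimal. In this mechanism the allocation is $(0,0)$ with payment $0$ on the exclusion region $\{z\in D: z_1<c_1+\delta_1,\ z_2<c_2+\delta_2\}$; outside this region it is $(1,0)$ with payment $c_1+\delta_1$ where $z_1-(c_1+\delta_1)\ge z_2-(c_2+\delta_2)$, and $(0,1)$ with payment $c_2+\delta_2$ elsewhere. (By $\delta_1-\delta_2\le b_1-b_2$, the $45^\circ$ line separating the last two regions ends on the top side of $D$.) -/

import Mathlib

open MeasureTheory Set

noncomputable section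

/-- The valuation set `[c₁, c₁ + b₁] × [c₂, c₂ + b₂]`. -/
def valuationRect (c₁ c₂ b₁ b₂ : ℝ) : Set (ℝ × ℝ) :=
  Icc c₁ (c₁ + b₁) ×ˢ Icc c₂ (c₂ + b₂)

/-- The uniform probability distribution on the set `D` (Lebesgue measure conditioned on `D`). -/
def uniformDist (D : Set (ℝ × ℝ)) : Measure (ℝ × ℝ) :=
  ProbabilityTheory.cond volume D

/-- A direct mechanism for two items and one buyer: an allocation function
`z ↦ (q₁ z, q₂ z)` and a payment function `t`. All requirements below concern
reports in the valuation set `D` only; the values outside `D` play no role. -/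
structure Mechanism where
  q₁ : ℝ × ℝ → ℝ
  q₂ : ℝ × ℝ → ℝ
  t : ℝ × ℝ → ℝ

namespace Mechanism

/-- Realized quasilinear utility of a buyer with valuation `z` who reports `w`. -/
def utility (M : Mechanism) (z w : ℝ × ℝ) : ℝ :=
  z.1 * M.q₁ w + z.2 * M.q₂ w - M.t w

/-- Unit demand: the allocation probabilities are nonnegative with sum at most one;
payments go from the buyer to the seller. -/
def IsUnitDemand (M : Mechanism) (D : Set (ℝ × ℝ)) : Prop :=
  ∀ z ∈ D, 0 ≤ M.q₁ z ∧ 0 ≤ M.q₂ z ∧ M.q₁ z + M.q₂ z ≤ 1 ∧ 0 ≤ M.t z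

/-- Incentive compatibility: truth telling is weakly dominant. -/
def IsIC (M : Mechanism) (D : Set (ℝ × ℝ)) : Prop :=
  ∀ z ∈ D, ∀ w ∈ D, M.utility z w ≤ M.utility z z

/-- Individual rationality: truthful participation yields nonnegative utility. -/
def IsIR (M : Mechanism) (D : Set (ℝ × ℝ)) : Prop :=
  ∀ z ∈ D, 0 ≤ M.utility z z

/-- Unit-demand mechanisms that are incentive compatible and individually rational. -/
def IsFeasible (M : Mechanism) (D : Set (ℝ × ℝ)) : Prop :=
  M.IsUnitDemand D ∧ M.IsIC D ∧ M.IsIR D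

/-- Expected payment when the valuation is uniformly distributed on `D`. -/
def revenue (M : Mechanism) (D : Set (ℝ × ℝ)) : ℝ :=
  ∫ z, M.t z ∂(uniformDist D)

/-- `M` is feasible, its expected payment exists, and no feasible mechanism has a larger one. -/
def IsOptimal (M : Mechanism) (D : Set (ℝ × ℝ)) : Prop :=
  M.IsFeasible D ∧ Integrable M.t (uniformDist D) ∧
    ∀ M' : Mechanism, M'.IsFeasible D → M'.revenue D ≤ M.revenue D

open Classical in
/-- The posted-price mechanism with price `p₁` for item 1 and `p₂` for item 2: the allocation is
`(0,0)` on the exclusion region `z₁ < p₁, z₂ < p₂`; outside it, it is `(1,0)` on or below the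
`45°` line through `(p₁, p₂)` and `(0,1)` above that line. -/
def postedPrice (p₁ p₂ : ℝ) : Mechanism where
  q₁ z := if p₁ ≤ z.1 ∧ z.2 - p₂ ≤ z.1 - p₁ then 1 else 0
  q₂ z := if p₂ ≤ z.2 ∧ z.1 - p₁ < z.2 - p₂ then 1 else 0
  t z := if p₁ ≤ z.1 ∧ z.2 - p₂ ≤ z.1 - p₁ then p₁
    else if p₂ ≤ z.2 ∧ z.1 - p₁ < z.2 - p₂ then p₂ else 0

end Mechanism

/-- The two simultaneous equations for `(δ₁, δ₂)`. -/
def PriceSystem (c₁ c₂ b₁ b₂ δ₁ δ₂ : ℝ) : Prop :=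
  -3 * δ₁ * δ₂ - c₂ * δ₁ - c₁ * δ₂ + b₁ * b₂ = 0 ∧
  -(3 / 2) * δ₂ ^ 2 + 2 * b₂ * δ₂ - b₂ ^ 2 / 2 - (c₁ - c₂) * (b₂ - δ₂)
    + (c₂ - 2 * b₂ + 3 * δ₂) * δ₁ = 0

/-- The pair `(δ₁, δ₂)` solves the two equations and the prices `c₁ + δ₁`, `c₂ + δ₂` lie strictly
inside the ranges of the two valuations. -/
def IsPriceSolution (c₁ c₂ b₁ b₂ δ₁ δ₂ : ℝ) : Prop :=
  δ₁ ∈ Ioo 0 b₁ ∧ δ₂ ∈ Ioo 0 b₂ ∧ PriceSystem c₁ c₂ b₁ b₂ δ₁ δ₂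

end

open MeasureTheory Set

/-! Incentive compatibility makes the truthful utility u of a feasible mechanism Lipschitz, with
gradient equal to the allocation almost everywhere. Hence t = z·∇u − u, and integration by parts
turns the total payment into a linear functional of u: weighted edge integrals minus three times the
area integral (`revenueFunctional`). It remains to see that this functional is nonpositive on g = u
− v, where v is the posted-price utility.

Unit demand gives u(w) − u(z) ≤ max(0, w₁ − z₁, w₂ − z₂). So in each sale region g does not increase
up a 45° line, and its value H at the point where the line leaves the rectangle is antitone in the
offset of the line (x − y for item 1, y − x for item 2). In the exclusion region v = 0 and g ≥ 0.
The functional is therefore at most a sum of two integrals ∫ H m, one per sale region, where m is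
the edge weights minus three times the length of the diagonal.

The price system says that both densities m have integral zero: shifting either price has no
first-order effect. Since m is, with one exception treated separately, first nonpositive and then
nonnegative, an antitone H gives ∫ H m ≤ 0 (`diagonal_dominance_right`, `diagonal_dominance_top`).
The sign pattern rests on `IsPriceSolution.slope_bounds`; existence of prices is an intermediate
value argument. -/

/-! ### The price system -/

theorem IsPriceSolution.slope_bounds {c₁ c₂ b₁ b₂ δ₁ δ₂ : ℝ} (h : 2 * c₁ - c₂ ≤ b₂)
    (hs : IsPriceSolution c₁ c₂ b₁ b₂ δ₁ δ₂) :
    c₂ + b₂ ≤ 3 * (b₂ - δ₂) ∧ 3 * (b₂ - δ₂) ≤ 2 * (c₂ + b₂ - c₁) := by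
  obtain ⟨⟨h1, h1'⟩, ⟨h2, h2'⟩, e1, e2⟩ := hs
  -- The second equation in terms of e = b₂ − δ₂. The two differences must have compatible signs,
  -- and `h` says c₂ + b₂ ≤ 2(c₂ + b₂ − c₁), so 3e lies between these values.
  have key : (b₂ - δ₂) * (2 * (c₂ + b₂ - c₁) - 3 * (b₂ - δ₂)) =
      2 * (δ₁ * (3 * (b₂ - δ₂) - (c₂ + b₂))) := by linear_combination 2 * e2
  have he : 0 < b₂ - δ₂ := by linarith
  by_cases hA : c₂ + b₂ ≤ 3 * (b₂ - δ₂)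
  · refine ⟨hA, ?_⟩
    have : 0 ≤ (b₂ - δ₂) * (2 * (c₂ + b₂ - c₁) - 3 * (b₂ - δ₂)) := by
      rw [key]; have := mul_nonneg h1.le (sub_nonneg.2 hA); linarith
    linarith [nonneg_of_mul_nonneg_right this he]
  · push Not at hA
    have h3 : δ₁ * (3 * (b₂ - δ₂) - (c₂ + b₂)) < 0 := mul_neg_of_pos_of_neg h1 (by linarith)
    have h4 : (b₂ - δ₂) * (2 * (c₂ + b₂ - c₁) - 3 * (b₂ - δ₂)) < 0 := by linarith
    have := neg_of_mul_neg_right h4 he.le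
    linarith

theorem IsPriceSolution.sub_le_sub {c₁ c₂ b₁ b₂ δ₁ δ₂ : ℝ} (hb : b₂ ≤ b₁)
    (hc₂ : 0 ≤ c₂) (hc : c₂ ≤ c₁) (h : 2 * c₁ - c₂ ≤ b₂)
    (hs : IsPriceSolution c₁ c₂ b₁ b₂ δ₁ δ₂) : δ₁ - δ₂ ≤ b₁ - b₂ := by
  obtain ⟨s1, s2⟩ := hs.slope_bounds h
  obtain ⟨⟨h1, h1'⟩, ⟨h2, h2'⟩, e1, e2⟩ := hs
  by_contra! hlt
  obtain ⟨e, rfl⟩ : ∃ e, δ₂ = b₂ - e := ⟨b₂ - δ₂, by ring⟩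
  have hr : 0 < δ₁ - (b₁ - e) := by linarith
  -- By the two equations, the quantities bounded in `hP`, `hQ`, `k1`, `k2` satisfy P + 2Q + k₁ + k₂
  -- = 0, although P > 0 and the others are nonnegative.
  have hP := mul_pos hr (show 0 < 3 * (b₂ - e) + c₂ by linarith)
  have hQ := mul_nonneg hr.le (show 0 ≤ 3 * e - c₂ - b₂ by linarith)
  have k1 := mul_nonneg (sub_nonneg.2 hb) (show 0 ≤ 3 * e - c₂ by linarith)
  have k2 := mul_nonneg (sub_nonneg.2 hc) (show 0 ≤ e + b₂ by linarith)
  linarith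

theorem exists_isPriceSolution {c₁ c₂ b₁ b₂ : ℝ} (hb₂ : 0 < b₂) (hb : b₂ ≤ b₁)
    (hc₂ : 0 ≤ c₂) (hc : c₂ ≤ c₁) (h : 2 * c₁ - c₂ ≤ b₂) :
    ∃ δ₁ δ₂ : ℝ, IsPriceSolution c₁ c₂ b₁ b₂ δ₁ δ₂ := by
  -- With e = b₂ − δ₂, the first equation gives δ₁ as a quotient with denominator 3δ₂ + c₂; F is the
  -- second equation after substitution and clearing of that denominator. Its zero is sought between
  -- the bounds of `slope_bounds`.
  let F : ℝ → ℝ := fun e => e * (c₂ + b₂ - c₁ - 3 / 2 * e) * (3 * (b₂ - e) + c₂)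
    - (b₁ * b₂ - c₁ * (b₂ - e)) * (3 * e - c₂ - b₂)
  have hcb : c₁ ≤ b₁ := by linarith
  have hpos : ∀ e, 0 < e → e < b₂ → 0 < b₁ * b₂ - c₁ * (b₂ - e) := by
    intro e he he'
    rcases (hc₂.trans hc).eq_or_lt with h0 | h0
    · rw [← h0]; have := mul_pos (hb₂.trans_le hb) hb₂; linarith
    · nlinarith [mul_pos h0 he, mul_nonneg (sub_nonneg.2 hcb) hb₂.le]
  have hlo : 0 ≤ F ((c₂ + b₂) / 3) := by
    have h1 : F ((c₂ + b₂) / 3) = (c₂ + b₂) / 3 * ((c₂ + b₂) / 2 - c₁) * (2 * b₂) := by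
      simp only [F]; ring
    rw [h1]
    exact mul_nonneg (mul_nonneg (by linarith) (by linarith)) (by linarith)
  have hhi : F (2 / 3 * (c₂ + b₂ - c₁)) ≤ 0 := by
    have h1 : F (2 / 3 * (c₂ + b₂ - c₁)) =
        -((b₁ * b₂ - c₁ * (b₂ - 2 / 3 * (c₂ + b₂ - c₁))) * (c₂ + b₂ - 2 * c₁)) := by
      simp only [F]; ring
    rw [h1, neg_nonpos]
    exact mul_nonneg (hpos _ (by linarith) (by linarith)).le (by linarith)
  obtain ⟨e, ⟨he1, he2⟩, hFe⟩ : ∃ e ∈ Icc ((c₂ + b₂) / 3) (2 / 3 * (c₂ + b₂ - c₁)), F e = 0 := by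
    have hcont : ContinuousOn F (Icc ((c₂ + b₂) / 3) (2 / 3 * (c₂ + b₂ - c₁))) := by
      apply Continuous.continuousOn; simp only [F]; fun_prop
    exact intermediate_value_Icc' (by linarith) hcont ⟨hhi, hlo⟩
  have hnum := hpos e (by linarith) (by linarith)
  have hden : 0 < 3 * (b₂ - e) + c₂ := by linarith
  obtain ⟨δ, hδ⟩ : ∃ δ, δ = (b₁ * b₂ - c₁ * (b₂ - e)) / (3 * (b₂ - e) + c₂) := ⟨_, rfl⟩
  have hδ' : δ * (3 * (b₂ - e) + c₂) = b₁ * b₂ - c₁ * (b₂ - e) := by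
    rw [hδ, div_mul_cancel₀ _ hden.ne']
  have hδ0 : 0 < δ := by rw [hδ]; positivity
  have heq : e * (c₂ + b₂ - c₁ - 3 / 2 * e) = δ * (3 * e - c₂ - b₂) := by
    apply mul_right_cancel₀ hden.ne'
    simp only [F] at hFe
    linear_combination hFe - (3 * e - c₂ - b₂) * hδ'
  refine ⟨δ, b₂ - e, ⟨hδ0, ?_⟩, ⟨by linarith, by linarith⟩, by linear_combination -hδ',
    by linear_combination heq⟩
  -- If δ ≥ b₁, then with δ₂ = b₂ − e the chain b₁b₂ ≥ b₁b₂ − c₁δ₂ = δ(3δ₂ + c₂) ≥ b₁(3δ₂ + c₂) ≥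
  -- b₁(b₂ + 2(c₁ − c₂)) ≥ b₁b₂ consists of equalities. This forces c₁ = c₂ = 0 and e = 2b₂/3, and
  -- the second equation then reads δb₂ = 0.
  by_contra! hge
  have h1 : 0 ≤ (δ - b₁) * (3 * (b₂ - e) + c₂) := mul_nonneg (by linarith) hden.le
  have hb₁ : 0 < b₁ := by linarith
  have h2 : 0 ≤ b₁ * (3 * (b₂ - e) + c₂ - b₂ - 2 * (c₁ - c₂)) := mul_nonneg hb₁.le (by linarith)
  have h3 : 0 ≤ b₁ * (2 * (c₁ - c₂)) := mul_nonneg hb₁.le (by linarith)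
  have h4 : 0 ≤ c₁ * (b₂ - e) := mul_nonneg (by linarith) (by linarith)
  have h5 : c₁ * (b₂ - e) = 0 := by linarith
  have h6 : c₁ = 0 := (mul_eq_zero.1 h5).resolve_right (by linarith)
  have h7 : c₂ = 0 := by linarith
  have h8 : 3 * (b₂ - e) + c₂ - b₂ - 2 * (c₁ - c₂) = 0 := by
    have : b₁ * (3 * (b₂ - e) + c₂ - b₂ - 2 * (c₁ - c₂)) = 0 := by linarith
    exact (mul_eq_zero.1 this).resolve_left hb₁.ne'
  have h9 : e = 2 / 3 * b₂ := by linarith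
  subst h6 h7 h9
  nlinarith [mul_pos hδ0 hb₂]

/-! ### Antitone functions against piecewise densities -/

/-- H − H v and m have opposite signs on either side of v. The right endpoint is exempt in `hpos`
because the density may drop there. -/
theorem intervalIntegral_mul_le_of_antitoneOn {H m : ℝ → ℝ} {a b v : ℝ} (hv : v ∈ Icc a b)
    (hH : AntitoneOn H (Icc a b)) (hcont : Continuous H) (hm : IntervalIntegrable m volume a b)
    (hneg : ∀ x ∈ Icc a b, x < v → m x ≤ 0) (hpos : ∀ x ∈ Ico a b, v < x → 0 ≤ m x) :
    ∫ x in a..b, H x * m x ≤ H v * ∫ x in a..b, m x := by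
  rw [← intervalIntegral.integral_const_mul]
  refine intervalIntegral.integral_mono_on_of_le_Ioo (hv.1.trans hv.2)
    (hm.continuousOn_mul hcont.continuousOn) (hm.const_mul _) fun x hx => ?_
  have hx' : x ∈ Icc a b := ⟨hx.1.le, hx.2.le⟩
  rcases lt_trichotomy x v with h | h | h
  · exact mul_le_mul_of_nonpos_right (hH hx' hv h.le) (hneg x hx' h)
  · rw [h]
  · exact mul_le_mul_of_nonneg_right (hH hv hx' h.le) (hpos x ⟨hx.1.le, hx.2⟩ h)

theorem intervalIntegrable_ite_lt (a b c p q : ℝ) :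
    IntervalIntegrable (fun x => if x < c then p else q) volume a b := by
  have : IntervalIntegrable (fun x => (Iio c).indicator (fun _ => p - q) x + q) volume a b := by
    refine IntervalIntegrable.add ?_ intervalIntegrable_const
    rw [intervalIntegrable_iff]
    exact (integrableOn_const (by simp)).indicator measurableSet_Iio
  refine this.congr fun x _ => ?_
  by_cases h : x < c <;> simp [h]

theorem intervalIntegral_mul_ite_lt {H : ℝ → ℝ} (hH : Continuous H) {a b c : ℝ} (hac : a ≤ c)
    (hcb : c ≤ b) (p q : ℝ) :
    ∫ x in a..b, H x * (if x < c then p else q) =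
      p * (∫ x in a..c, H x) + q * ∫ x in c..b, H x := by
  have hi : ∀ a b, IntervalIntegrable (fun x => H x * (if x < c then p else q)) volume a b :=
    fun a b => (intervalIntegrable_ite_lt a b c p q).continuousOn_mul hH.continuousOn
  rw [← intervalIntegral.integral_add_adjacent_intervals (hi a c) (hi c b)]
  congr 1
  · rw [← intervalIntegral.integral_const_mul, intervalIntegral.integral_of_le hac,
      intervalIntegral.integral_of_le hac, integral_Ioc_eq_integral_Ioo,
      integral_Ioc_eq_integral_Ioo]
    refine setIntegral_congr_fun measurableSet_Ioo fun x hx => ?_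
    simp [hx.2, mul_comm]
  · rw [← intervalIntegral.integral_const_mul]
    refine intervalIntegral.integral_congr fun x hx => ?_
    rw [uIcc_of_le hcb] at hx
    simp [not_lt.2 hx.1, mul_comm]

theorem intervalIntegral_min_add {a b A B : ℝ} (h1 : a ≤ A - B) (h2 : A - B ≤ b) :
    ∫ v in a..b, min A (v + B) =
      ((A - B) ^ 2 - a ^ 2) / 2 + B * (A - B - a) + A * (b - (A - B)) := by
  have hi : ∀ a b, IntervalIntegrable (fun v => min A (v + B)) volume a b :=
    fun a b => Continuous.intervalIntegrable (by fun_prop) _ _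
  rw [← intervalIntegral.integral_add_adjacent_intervals (hi a (A - B)) (hi (A - B) b)]
  have e1 : ∫ v in a..A - B, min A (v + B) = ∫ v in a..A - B, (v + B) := by
    refine intervalIntegral.integral_congr fun v hv => ?_
    rw [uIcc_of_le h1] at hv
    exact min_eq_right (by linarith [hv.2])
  have e2 : ∫ v in A - B..b, min A (v + B) = ∫ v in A - B..b, A := by
    refine intervalIntegral.integral_congr fun v hv => ?_
    rw [uIcc_of_le h2] at hv
    exact min_eq_left (by linarith [hv.1])
  rw [e1, e2, intervalIntegral.integral_add (by simp) (by simp)]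
  simp only [integral_id, intervalIntegral.integral_const, smul_eq_mul]
  ring

theorem intervalIntegral_max_add {a b A B : ℝ} (h1 : a ≤ A - B) (h2 : A - B ≤ b) :
    ∫ v in a..b, max A (v + B) =
      A * (A - B - a) + (b ^ 2 - (A - B) ^ 2) / 2 + B * (b - (A - B)) := by
  have e : ∀ v, max A (v + B) = (A + (v + B)) - min A (v + B) := fun v => by
    rw [eq_sub_iff_add_eq, max_add_min]
  simp_rw [e]
  rw [intervalIntegral.integral_sub (Continuous.intervalIntegrable (by fun_prop) _ _)
    (Continuous.intervalIntegrable (by fun_prop) _ _), intervalIntegral_min_add h1 h2,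
    intervalIntegral.integral_add (by simp) (Continuous.intervalIntegrable (by fun_prop) _ _),
    intervalIntegral.integral_add (by simp) (by simp)]
  simp only [integral_id, intervalIntegral.integral_const, smul_eq_mul]
  ring

/-- Length of the part with `p₁ ≤ x ≤ A₁`, `a₂ ≤ y ≤ A₂` of the line `x - y = v`, measured by its
projection to the first axis. -/
def diagLength (A₁ a₂ A₂ p₁ v : ℝ) : ℝ := min A₁ (v + A₂) - max p₁ (v + a₂)

@[fun_prop]
theorem continuous_diagLength (A₁ a₂ A₂ p₁ : ℝ) : Continuous (diagLength A₁ a₂ A₂ p₁) := by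
  unfold diagLength; fun_prop

/-! ### Sign analysis of the densities of the two sale regions -/

/-- The item-1 region, with v = x − y. Its diagonals leave through the top for v < A₁ − A₂ and
through the right edge afterwards; they start on the bottom edge once v ≥ p₁ − a₂. These two
thresholds are the jumps of the density, and `htot` says that its mass is zero. -/
theorem diagonal_dominance_right {H : ℝ → ℝ} (hcont : Continuous H) {A₁ a₂ A₂ p₁ p₂ : ℝ}
    (hH : AntitoneOn H (Icc (p₁ - p₂) (A₁ - a₂))) (ha₂ : 0 ≤ a₂) (hap : a₂ ≤ p₂) (hpA₂ : p₂ ≤ A₂)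
    (hpA₁ : p₁ ≤ A₁) (hpp : p₁ - p₂ ≤ A₁ - A₂) (hslope : A₂ ≤ 3 * (A₂ - p₂)) (haA : 2 * a₂ ≤ A₁)
    (htot : A₁ * (A₂ - a₂) + A₂ * (A₁ - A₂ - (p₁ - p₂)) - a₂ * (A₁ - p₁)
      - 3 * ((A₁ - p₁) * (A₂ - a₂) - (A₂ - p₂) ^ 2 / 2) = 0) :
    A₁ * (∫ v in A₁ - A₂..A₁ - a₂, H v) + A₂ * (∫ v in p₁ - p₂..A₁ - A₂, H v)
      - a₂ * (∫ v in p₁ - a₂..A₁ - a₂, H v)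
      - 3 * ∫ v in p₁ - p₂..A₁ - a₂, H v * diagLength A₁ a₂ A₂ p₁ v ≤ 0 := by
  let m : ℝ → ℝ := fun v => (if v < A₁ - A₂ then A₂ else A₁) - (if v < p₁ - a₂ then 0 else a₂)
    - 3 * diagLength A₁ a₂ A₂ p₁ v
  have hi1 := intervalIntegrable_ite_lt (c := A₁ - A₂) (p := A₂) (q := A₁)
  have hi2 := intervalIntegrable_ite_lt (c := p₁ - a₂) (p := 0) (q := a₂)
  have hi3 : ∀ a b, IntervalIntegrable (fun v => 3 * diagLength A₁ a₂ A₂ p₁ v) volume a b :=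
    fun a b => Continuous.intervalIntegrable (by fun_prop) _ _
  have hm : ∀ a b, IntervalIntegrable m volume a b :=
    fun a b => ((hi1 a b).sub (hi2 a b)).sub (hi3 a b)
  have expand : ∀ G : ℝ → ℝ, Continuous G → ∫ v in p₁ - p₂..A₁ - a₂, G v * m v =
      A₁ * (∫ v in A₁ - A₂..A₁ - a₂, G v) + A₂ * (∫ v in p₁ - p₂..A₁ - A₂, G v)
      - a₂ * (∫ v in p₁ - a₂..A₁ - a₂, G v)
      - 3 * ∫ v in p₁ - p₂..A₁ - a₂, G v * diagLength A₁ a₂ A₂ p₁ v := by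
    intro G hG
    have hc := hG.continuousOn (s := uIcc (p₁ - p₂) (A₁ - a₂))
    simp only [m, mul_sub]
    rw [intervalIntegral.integral_sub (((hi1 _ _).continuousOn_mul hc).sub
        ((hi2 _ _).continuousOn_mul hc)) ((hi3 _ _).continuousOn_mul hc),
      intervalIntegral.integral_sub ((hi1 _ _).continuousOn_mul hc)
        ((hi2 _ _).continuousOn_mul hc),
      intervalIntegral_mul_ite_lt hG hpp (by linarith),
      intervalIntegral_mul_ite_lt hG (by linarith) (by linarith)]
    simp_rw [mul_left_comm _ (3 : ℝ)]
    rw [intervalIntegral.integral_const_mul]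
    ring
  -- The expansion with H = 1.
  have hzero : ∫ v in p₁ - p₂..A₁ - a₂, m v = 0 := by
    have := expand (fun _ => 1) continuous_const
    simp only [one_mul, intervalIntegral.integral_const, smul_eq_mul, mul_one] at this
    rw [this]
    unfold diagLength
    rw [intervalIntegral.integral_sub (Continuous.intervalIntegrable (by fun_prop) _ _)
      (Continuous.intervalIntegrable (by fun_prop) _ _),
      intervalIntegral_min_add hpp (by linarith),
      intervalIntegral_max_add (by linarith) (by linarith)]
    linear_combination htot
  rw [← expand H hcont]
  have hlow : ∀ v, p₁ - p₂ ≤ v → v < A₁ - A₂ → m v ≤ 0 := by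
    intro v h1 h2
    simp only [m, diagLength, if_pos h2]
    rw [min_eq_right (by linarith)]
    split_ifs with h3
    · rw [max_eq_left (by linarith)]; linarith
    · rw [max_eq_right (by linarith)]; linarith
  have hup : ∀ v, p₁ - a₂ ≤ v → A₁ - A₂ ≤ v → m v = 3 * v - 2 * (A₁ - a₂) := by
    intro v h1 h2
    simp only [m, diagLength, if_neg (not_lt.2 h1), if_neg (not_lt.2 h2)]
    rw [min_eq_left (by linarith), max_eq_right (by linarith)]; ring
  have hmid : ∀ v, A₁ - A₂ ≤ v → v < p₁ - a₂ → m v = A₁ - 3 * (A₁ - p₁) := by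
    intro v h1 h2
    simp only [m, diagLength, if_neg (not_lt.2 h1), if_pos h2]
    rw [min_eq_left (by linarith), max_eq_left (by linarith)]; ring
  have hω : 0 ≤ A₁ - a₂ := by linarith
  -- In this case m is positive before p₁ − a₂ and may turn negative again after dropping by a₂, so
  -- single crossing can fail. Each side of p₁ − a₂ has single crossing by itself, and the right
  -- part has nonnegative mass, so its reference value of H can be raised to H (A₁ − A₂), the one
  -- used on the left.
  by_cases hcase : A₁ - A₂ < p₁ - a₂ ∧ 0 < A₁ - 3 * (A₁ - p₁)
  · obtain ⟨hβγ, hpos⟩ := hcase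
    have hb : ∫ v in p₁ - a₂..A₁ - a₂, m v = (A₁ - p₁) / 2 * (2 * (A₁ - a₂) - 3 * (A₁ - p₁)) := by
      have : ∫ v in p₁ - a₂..A₁ - a₂, m v = ∫ v in p₁ - a₂..A₁ - a₂, (3 * v - 2 * (A₁ - a₂)) := by
        refine intervalIntegral.integral_congr fun v hv => ?_
        rw [uIcc_of_le (by linarith)] at hv
        exact hup v hv.1 (by linarith [hv.1])
      rw [this, intervalIntegral.integral_sub (Continuous.intervalIntegrable (by fun_prop) _ _)
        (by simp), intervalIntegral.integral_const_mul]
      simp only [integral_id, intervalIntegral.integral_const, smul_eq_mul]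
      ring
    have hb0 : 0 ≤ ∫ v in p₁ - a₂..A₁ - a₂, m v := by
      rw [hb]; exact mul_nonneg (by linarith) (by linarith)
    have hv₁ : max (p₁ - a₂) (2 / 3 * (A₁ - a₂)) ∈ Icc (p₁ - a₂) (A₁ - a₂) :=
      ⟨le_max_left _ _, max_le (by linarith) (by linarith)⟩
    have h1 := intervalIntegral_mul_le_of_antitoneOn hv₁
      (hH.mono (Icc_subset_Icc (by linarith) le_rfl)) hcont (hm _ _)
      (fun x hx hxv => by
        rcases lt_max_iff.1 hxv with h | h
        · linarith [hx.1]
        · rw [hup x hx.1 (by linarith [hx.1])]; linarith)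
      (fun x hx hxv => by
        rw [hup x hx.1 (by linarith [hx.1])]; linarith [(max_lt_iff.1 hxv).2])
    have h2 := intervalIntegral_mul_le_of_antitoneOn (a := p₁ - p₂) (b := p₁ - a₂)
      ⟨hpp, hβγ.le⟩ (hH.mono (Icc_subset_Icc le_rfl (by linarith))) hcont (hm _ _)
      (fun x hx hxv => hlow x hx.1 hxv)
      (fun x hx hxv => by rw [hmid x hxv.le hx.2]; exact hpos.le)
    have h3 : H (max (p₁ - a₂) (2 / 3 * (A₁ - a₂))) ≤ H (A₁ - A₂) :=
      hH ⟨hpp, by linarith⟩ ⟨by linarith [hv₁.1], hv₁.2⟩ (hβγ.le.trans hv₁.1)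
    have h4 := intervalIntegral.integral_add_adjacent_intervals
      ((hm (p₁ - p₂) (p₁ - a₂)).continuousOn_mul hcont.continuousOn)
      ((hm (p₁ - a₂) (A₁ - a₂)).continuousOn_mul hcont.continuousOn)
    have h5 := intervalIntegral.integral_add_adjacent_intervals
      (hm (p₁ - p₂) (p₁ - a₂)) (hm (p₁ - a₂) (A₁ - a₂))
    rw [hzero] at h5
    have h6 := mul_le_mul_of_nonneg_right h3 hb0
    have h7 : H (A₁ - A₂) * (∫ v in p₁ - p₂..p₁ - a₂, m v) +
      H (A₁ - A₂) * (∫ v in p₁ - a₂..A₁ - a₂, m v) = 0 := by rw [← mul_add, h5, mul_zero]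
    linarith
  · have hv₁ : max (max (A₁ - A₂) (p₁ - a₂)) (2 / 3 * (A₁ - a₂)) ∈ Icc (p₁ - p₂) (A₁ - a₂) :=
      ⟨hpp.trans ((le_max_left _ _).trans (le_max_left _ _)),
        max_le (max_le (by linarith) (by linarith)) (by linarith)⟩
    refine (intervalIntegral_mul_le_of_antitoneOn hv₁ hH hcont (hm _ _) ?_ ?_).trans_eq
      (by rw [hzero, mul_zero])
    · intro x hx hxv
      rcases lt_or_ge x (A₁ - A₂) with h1 | h1
      · exact hlow x hx.1 h1
      rcases lt_or_ge x (p₁ - a₂) with h2 | h2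
      · rw [hmid x h1 h2]
        by_contra! h3
        exact hcase ⟨h1.trans_lt h2, h3⟩
      · rw [hup x h2 h1]
        rcases lt_max_iff.1 hxv with h | h
        · rcases lt_max_iff.1 h with h | h <;> linarith
        · linarith
    · intro x hx hxv
      obtain ⟨h1, h2⟩ := max_lt_iff.1 hxv
      obtain ⟨h3, h4⟩ := max_lt_iff.1 h1
      rw [hup x h4.le h3.le]; linarith

/-- The item-2 region, with v = y − x. By `hpp` all its diagonals leave through the top, so the only
jump is at p₂ − a₁ and the density has single crossing. -/
theorem diagonal_dominance_top {H : ℝ → ℝ} (hcont : Continuous H) {A₁ a₁ A₂ p₁ p₂ : ℝ}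
    (hH : AntitoneOn H (Icc (p₂ - p₁) (A₂ - a₁))) (hap : a₁ ≤ p₁) (hpA₂ : p₂ ≤ A₂) (ha : a₁ ≤ A₂)
    (hpp : A₂ - A₁ ≤ p₂ - p₁) (hslope : A₂ ≤ 3 * (A₂ - p₂))
    (htot : A₂ * (A₂ - a₁ - (p₂ - p₁)) - a₁ * (A₂ - p₂)
      - 3 * ((A₂ - p₂) * (p₁ - a₁) + (A₂ - p₂) ^ 2 / 2) = 0) :
    A₂ * (∫ v in p₂ - p₁..A₂ - a₁, H v) - a₁ * (∫ v in p₂ - a₁..A₂ - a₁, H v)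
      - 3 * ∫ v in p₂ - p₁..A₂ - a₁, H v * diagLength A₂ a₁ A₁ p₂ v ≤ 0 := by
  let m : ℝ → ℝ := fun v => A₂ - (if v < p₂ - a₁ then 0 else a₁) - 3 * diagLength A₂ a₁ A₁ p₂ v
  have hi2 := intervalIntegrable_ite_lt (c := p₂ - a₁) (p := 0) (q := a₁)
  have hi3 : ∀ a b, IntervalIntegrable (fun v => 3 * diagLength A₂ a₁ A₁ p₂ v) volume a b :=
    fun a b => Continuous.intervalIntegrable (by fun_prop) _ _
  have hm : IntervalIntegrable m volume (p₂ - p₁) (A₂ - a₁) :=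
    (intervalIntegrable_const.sub (hi2 _ _)).sub (hi3 _ _)
  have expand : ∀ G : ℝ → ℝ, Continuous G → ∫ v in p₂ - p₁..A₂ - a₁, G v * m v =
      A₂ * (∫ v in p₂ - p₁..A₂ - a₁, G v) - a₁ * (∫ v in p₂ - a₁..A₂ - a₁, G v)
      - 3 * ∫ v in p₂ - p₁..A₂ - a₁, G v * diagLength A₂ a₁ A₁ p₂ v := by
    intro G hG
    have hc := hG.continuousOn (s := uIcc (p₂ - p₁) (A₂ - a₁))
    have hi1 := hG.intervalIntegrable (μ := volume) (p₂ - p₁) (A₂ - a₁)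
    simp only [m, mul_sub]
    rw [intervalIntegral.integral_sub ((hi1.mul_const _).sub
        ((hi2 _ _).continuousOn_mul hc)) ((hi3 _ _).continuousOn_mul hc),
      intervalIntegral.integral_sub (hi1.mul_const _) ((hi2 _ _).continuousOn_mul hc),
      intervalIntegral_mul_ite_lt hG (by linarith) (by linarith),
      intervalIntegral.integral_mul_const]
    simp_rw [mul_left_comm _ (3 : ℝ)]
    rw [intervalIntegral.integral_const_mul]
    ring
  have hlen : ∀ v, p₂ - p₁ ≤ v → diagLength A₂ a₁ A₁ p₂ v = A₂ - max p₂ (v + a₁) := by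
    intro v hv
    rw [diagLength, min_eq_left (by linarith)]
  have hzero : ∫ v in p₂ - p₁..A₂ - a₁, m v = 0 := by
    have := expand (fun _ => 1) continuous_const
    simp only [one_mul, intervalIntegral.integral_const, smul_eq_mul, mul_one] at this
    have hl : ∫ v in p₂ - p₁..A₂ - a₁, diagLength A₂ a₁ A₁ p₂ v =
        ∫ v in p₂ - p₁..A₂ - a₁, (A₂ - max p₂ (v + a₁)) := by
      refine intervalIntegral.integral_congr fun v hv => ?_
      rw [uIcc_of_le (by linarith)] at hv
      exact hlen v hv.1
    rw [this, hl,
      intervalIntegral.integral_sub (by simp) (Continuous.intervalIntegrable (by fun_prop) _ _),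
      intervalIntegral_max_add (by linarith) (by linarith)]
    simp only [intervalIntegral.integral_const, smul_eq_mul]
    linear_combination htot
  rw [← expand H hcont]
  have hv₁ : max (p₂ - a₁) (2 / 3 * (A₂ - a₁)) ∈ Icc (p₂ - p₁) (A₂ - a₁) :=
    ⟨(show p₂ - p₁ ≤ p₂ - a₁ by linarith).trans (le_max_left _ _),
      max_le (by linarith) (by linarith)⟩
  have hup : ∀ v, p₂ - p₁ ≤ v → p₂ - a₁ ≤ v → m v = 3 * v - 2 * (A₂ - a₁) := by
    intro v h1 h2
    simp only [m, hlen v h1, if_neg (not_lt.2 h2)]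
    rw [max_eq_right (by linarith)]; ring
  refine (intervalIntegral_mul_le_of_antitoneOn hv₁ hH hcont hm ?_ ?_).trans_eq
    (by rw [hzero, mul_zero])
  · intro x hx hxv
    rcases lt_or_ge x (p₂ - a₁) with h | h
    · simp only [m, hlen x hx.1, if_pos h]
      rw [max_eq_left (by linarith)]; linarith
    · rw [hup x hx.1 h]
      rcases lt_max_iff.1 hxv with h' | h' <;> linarith
  · intro x hx hxv
    obtain ⟨h1, h2⟩ := max_lt_iff.1 hxv
    rw [hup x hx.1 h1.le]; linarith

/-! ### Area integrals along diagonals -/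

/-- The shear (x, y) ↦ (x − y, y) preserves area; Fubini then leaves the length of each slice, cut
off at 0 where the slice is empty. -/
theorem setIntegral_comp_fst_sub_snd {H : ℝ → ℝ} (hH : Continuous H) {S : Set ℝ}
    (hS : MeasurableSet S) (A₁ a₂ A₂ p₁ : ℝ) :
    ∫ z in {z : ℝ × ℝ | z.1 ∈ Icc p₁ A₁ ∧ z.2 ∈ Icc a₂ A₂ ∧ z.1 - z.2 ∈ S}, H (z.1 - z.2) =
      ∫ v in S, H v * max 0 (diagLength A₁ a₂ A₂ p₁ v) := by
  let R : Set (ℝ × ℝ) := {w | w.1 + w.2 ∈ Icc p₁ A₁ ∧ w.2 ∈ Icc a₂ A₂ ∧ w.1 ∈ S}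
  have hR : MeasurableSet R :=
    (measurableSet_Icc.preimage (measurable_fst.add measurable_snd)).inter
      ((measurableSet_Icc.preimage measurable_snd).inter (hS.preimage measurable_fst))
  have hT := measurePreserving_sub_prod (G := ℝ) volume volume
  have hHm : Continuous fun w : ℝ × ℝ => H w.1 := hH.comp continuous_fst
  have h1 : ∫ z in {z : ℝ × ℝ | z.1 ∈ Icc p₁ A₁ ∧ z.2 ∈ Icc a₂ A₂ ∧ z.1 - z.2 ∈ S},
      H (z.1 - z.2) = ∫ w in R, H w.1 := by
    have := setIntegral_map (μ := (volume : Measure (ℝ × ℝ))) (f := fun w : ℝ × ℝ => H w.1)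
      hR hHm.aestronglyMeasurable hT.measurable.aemeasurable
    have hmap : Measure.map (fun z : ℝ × ℝ => (z.1 - z.2, z.2)) volume = volume := hT.map_eq
    rw [hmap] at this
    rw [this]
    congr 3
    ext z
    simp [R]
  have hint : Integrable (R.indicator fun w => H w.1) (volume : Measure (ℝ × ℝ)) := by
    rw [integrable_indicator_iff hR]
    have hK : IsCompact (Icc (p₁ - A₂) (A₁ - a₂) ×ˢ Icc a₂ A₂) := isCompact_Icc.prod isCompact_Icc
    refine (hHm.continuousOn.integrableOn_compact hK).mono_set fun w hw => ?_
    obtain ⟨⟨h1, h2⟩, ⟨h3, h4⟩, -⟩ := hw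
    exact ⟨⟨by linarith, by linarith⟩, h3, h4⟩
  rw [h1, ← integral_indicator hR, Measure.volume_eq_prod, integral_prod _ hint,
    ← integral_indicator hS]
  congr 1
  ext v
  by_cases hv : v ∈ S
  · have h2 : ∀ y, R.indicator (fun w => H w.1) (v, y) =
        (Icc (max a₂ (p₁ - v)) (min A₂ (A₁ - v))).indicator (fun _ => H v) y := by
      intro y
      refine indicator_eq_indicator ?_ rfl
      simp only [R, mem_ofPred_eq, hv, and_true, mem_Icc, max_le_iff, le_min_iff]
      constructor
      · rintro ⟨⟨h1, h2⟩, h3, h4⟩; exact ⟨⟨h3, by linarith⟩, h4, by linarith⟩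
      · rintro ⟨⟨h1, h2⟩, h3, h4⟩; exact ⟨⟨by linarith, by linarith⟩, h1, h3⟩
    simp_rw [h2]
    rw [integral_indicator measurableSet_Icc, setIntegral_const, smul_eq_mul,
      indicator_of_mem hv, mul_comm, Real.volume_real_Icc, max_comm]
    congr 2
    have h3 : diagLength A₁ a₂ A₂ p₁ v = min (A₁ - v) A₂ + v - (max (p₁ - v) a₂ + v) := by
      rw [diagLength, ← min_add_add_right, ← max_add_add_right]
      simp [add_comm]
    rw [h3, min_comm, max_comm a₂]; ring
  · rw [indicator_of_notMem hv]
    refine integral_eq_zero_of_ae (ae_of_all _ fun y => indicator_of_notMem ?_ _)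
    exact fun h => hv h.2.2

theorem setIntegral_Ioi_mul_diagLength {H : ℝ → ℝ} {A₁ a₂ A₂ p₁ α : ℝ} (hpA : p₁ ≤ A₁)
    (haA : a₂ ≤ A₂) (h1 : p₁ - A₂ ≤ α) (h2 : α ≤ A₁ - a₂) :
    ∫ v in Ioi α, H v * max 0 (diagLength A₁ a₂ A₂ p₁ v) =
      ∫ v in α..A₁ - a₂, H v * diagLength A₁ a₂ A₂ p₁ v := by
  rw [intervalIntegral.integral_of_le h2,
    setIntegral_eq_of_subset_of_forall_sdiff_eq_zero measurableSet_Ioi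
      (show Ioc α (A₁ - a₂) ⊆ Ioi α from Ioc_subset_Ioi_self)]
  · refine setIntegral_congr_fun measurableSet_Ioc fun v hv => ?_
    rw [max_eq_right]
    rw [diagLength, sub_nonneg]
    exact le_min (max_le hpA (by linarith [hv.2]))
      (max_le (by linarith [hv.1]) (by linarith))
  · intro v hv
    have hv' : A₁ - a₂ < v := by
      by_contra! h; exact hv.2 ⟨hv.1, h⟩
    rw [max_eq_left, mul_zero]
    rw [diagLength, sub_nonpos]
    exact (min_le_left _ _).trans (le_max_of_le_right (by linarith))

/-- The expected payment, up to the factor `volume D`, of a mechanism with utility `u` on the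
rectangle `D = [a₁, A₁] × [a₂, A₂]`, after integration by parts. -/
noncomputable def revenueFunctional (a₁ A₁ a₂ A₂ : ℝ) (u : ℝ × ℝ → ℝ) : ℝ :=
  A₁ * (∫ y in a₂..A₂, u (A₁, y)) - a₁ * (∫ y in a₂..A₂, u (a₁, y))
    + A₂ * (∫ x in a₁..A₁, u (x, A₂)) - a₂ * (∫ x in a₁..A₁, u (x, a₂))
    - 3 * ∫ z in Icc a₁ A₁ ×ˢ Icc a₂ A₂, u z

theorem revenueFunctional_sub {u v : ℝ × ℝ → ℝ} (hu : Continuous u) (hv : Continuous v)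
    (a₁ A₁ a₂ A₂ : ℝ) :
    revenueFunctional a₁ A₁ a₂ A₂ (fun z => u z - v z) =
      revenueFunctional a₁ A₁ a₂ A₂ u - revenueFunctional a₁ A₁ a₂ A₂ v := by
  have hK : IsCompact (Icc a₁ A₁ ×ˢ Icc a₂ A₂) := isCompact_Icc.prod isCompact_Icc
  simp only [revenueFunctional]
  rw [intervalIntegral.integral_sub, intervalIntegral.integral_sub, intervalIntegral.integral_sub,
    intervalIntegral.integral_sub, integral_sub (hu.continuousOn.integrableOn_compact hK)
    (hv.continuousOn.integrableOn_compact hK)]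
  · ring
  all_goals exact Continuous.intervalIntegrable (by fun_prop) _ _

/-- Utility of the posted-price mechanism. -/
noncomputable def postedUtility (p₁ p₂ : ℝ) (z : ℝ × ℝ) : ℝ := max 0 (max (z.1 - p₁) (z.2 - p₂))

@[fun_prop]
theorem continuous_postedUtility (p₁ p₂ : ℝ) : Continuous (postedUtility p₁ p₂) := by
  unfold postedUtility; fun_prop

/-! ### Comparison with the posted-price utility -/

/-- The point is where the diagonal x − y = v leaves through the top or right edge. As v grows, this
point moves right and then down, so u gains at most the increment of x, which is exactly what the
posted utility x − p₁ gains. -/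
theorem antitoneOn_sub_postedUtility_diagonal {u : ℝ × ℝ → ℝ} {A₁ A₂ p₁ p₂ ω : ℝ}
    (hu : ∀ z w, u w - u z ≤ max 0 (max (w.1 - z.1) (w.2 - z.2)))
    (hpA₁ : p₁ ≤ A₁) (hpA₂ : p₂ ≤ A₂) :
    AntitoneOn (fun v => u (min A₁ (v + A₂), min A₁ (v + A₂) - v) -
      postedUtility p₁ p₂ (min A₁ (v + A₂), min A₁ (v + A₂) - v)) (Icc (p₁ - p₂) ω) := by
  have key : ∀ v, p₁ - p₂ ≤ v → postedUtility p₁ p₂ (min A₁ (v + A₂), min A₁ (v + A₂) - v) =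
      min A₁ (v + A₂) - p₁ := by
    intro v hv
    have : p₁ ≤ min A₁ (v + A₂) := le_min hpA₁ (by linarith)
    simp only [postedUtility]
    rw [max_eq_left (a := min A₁ (v + A₂) - p₁) (by linarith), max_eq_right (by linarith)]
  intro v hv w hw hvw
  dsimp only
  rw [key v hv.1, key w hw.1]
  have h1 : min A₁ (v + A₂) ≤ min A₁ (w + A₂) := min_le_min le_rfl (by linarith)
  have h2 : min A₁ (w + A₂) ≤ min A₁ (v + A₂) + (w - v) := by
    rw [← min_add_add_right]
    exact min_le_min (by linarith) (by linarith)
  have h3 := hu (min A₁ (v + A₂), min A₁ (v + A₂) - v) (min A₁ (w + A₂), min A₁ (w + A₂) - w)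
  have h4 := h3.trans (max_le (by linarith) (max_le le_rfl (by dsimp only; linarith)) :
    _ ≤ min A₁ (w + A₂) - min A₁ (v + A₂))
  linarith

/-- Up a diagonal, u grows at rate at most 1 and the posted utility at rate exactly 1. -/
theorem diagonal_le_sub_postedUtility {u : ℝ × ℝ → ℝ} {A₁ A₂ p₁ p₂ : ℝ}
    (hu : ∀ z w, u w - u z ≤ max 0 (max (w.1 - z.1) (w.2 - z.2))) {x y : ℝ} (hxp : p₁ ≤ x)
    (hxA : x ≤ A₁) (hyA : y ≤ A₂) (hxy : p₁ - p₂ ≤ x - y) :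
    u (min A₁ (x - y + A₂), min A₁ (x - y + A₂) - (x - y)) -
      postedUtility p₁ p₂ (min A₁ (x - y + A₂), min A₁ (x - y + A₂) - (x - y)) ≤
      u (x, y) - postedUtility p₁ p₂ (x, y) := by
  have hx : x ≤ min A₁ (x - y + A₂) := le_min hxA (by linarith)
  simp only [postedUtility]
  rw [max_eq_left (a := x - p₁) (by linarith), max_eq_right (b := x - p₁) (by linarith),
    max_eq_left (a := min A₁ (x - y + A₂) - p₁) (by linarith),
    max_eq_right (b := min A₁ (x - y + A₂) - p₁) (by linarith)]
  have h3 := (hu (x, y) (min A₁ (x - y + A₂), min A₁ (x - y + A₂) - (x - y))).trans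
    (max_le (by linarith) (max_le le_rfl (by dsimp only; linarith)) :
    _ ≤ min A₁ (x - y + A₂) - x)
  linarith

theorem postedUtility_swap (p₁ p₂ : ℝ) (z : ℝ × ℝ) :
    postedUtility p₁ p₂ z.swap = postedUtility p₂ p₁ z := by
  simp [postedUtility, max_comm (z.2 - p₁)]

/-- The right edge and the top edge consist of exit points, so g equals H or K there. The left,
bottom and area terms have nonpositive weights, so g may be lowered to H or K in the sale regions
and to 0 in the exclusion region. -/
theorem revenueFunctional_le_postedUtility {u : ℝ × ℝ → ℝ} (hcont : Continuous u)
    {a₁ A₁ a₂ A₂ p₁ p₂ : ℝ} (ha₁ : 0 ≤ a₁) (ha₂ : 0 ≤ a₂) (hap₁ : a₁ ≤ p₁) (hpA₁ : p₁ ≤ A₁)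
    (hap₂ : a₂ ≤ p₂) (hpA₂ : p₂ ≤ A₂)
    (hu : ∀ z w, u w - u z ≤ max 0 (max (w.1 - z.1) (w.2 - z.2)))
    (hu0 : ∀ z ∈ Icc a₁ A₁ ×ˢ Icc a₂ A₂, 0 ≤ u z)
    (hpp : p₁ - p₂ ≤ A₁ - A₂) (hslope : A₂ ≤ 3 * (A₂ - p₂)) (haA : 2 * a₂ ≤ A₁) (ha : a₁ ≤ A₂)
    (hright : A₁ * (A₂ - a₂) + A₂ * (A₁ - A₂ - (p₁ - p₂)) - a₂ * (A₁ - p₁)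
      - 3 * ((A₁ - p₁) * (A₂ - a₂) - (A₂ - p₂) ^ 2 / 2) = 0)
    (htop : A₂ * (A₂ - a₁ - (p₂ - p₁)) - a₁ * (A₂ - p₂)
      - 3 * ((A₂ - p₂) * (p₁ - a₁) + (A₂ - p₂) ^ 2 / 2) = 0) :
    revenueFunctional a₁ A₁ a₂ A₂ u ≤ revenueFunctional a₁ A₁ a₂ A₂ (postedUtility p₁ p₂) := by
  rw [← sub_nonpos, ← revenueFunctional_sub hcont (by fun_prop)]
  set g : ℝ × ℝ → ℝ := fun z => u z - postedUtility p₁ p₂ z with hg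
  have hgc : Continuous g := by fun_prop
  let H : ℝ → ℝ := fun v => g (min A₁ (v + A₂), min A₁ (v + A₂) - v)
  let K : ℝ → ℝ := fun v => g (min A₂ (v + A₁) - v, min A₂ (v + A₁))
  have hHc : Continuous H := by fun_prop
  have hKc : Continuous K := by fun_prop
  have hH : AntitoneOn H (Icc (p₁ - p₂) (A₁ - a₂)) :=
    antitoneOn_sub_postedUtility_diagonal hu hpA₁ hpA₂
  have hu' : ∀ z w : ℝ × ℝ, u w.swap - u z.swap ≤ max 0 (max (w.1 - z.1) (w.2 - z.2)) :=
    fun z w => by rw [max_comm (w.1 - z.1)]; exact hu z.swap w.swap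
  have hK : AntitoneOn K (Icc (p₂ - p₁) (A₂ - a₁)) := by
    have := antitoneOn_sub_postedUtility_diagonal (u := fun z => u z.swap) (ω := A₂ - a₁)
      hu' hpA₂ hpA₁
    simp_rw [← postedUtility_swap p₁ p₂] at this
    exact this
  have hgH : ∀ x y, p₁ ≤ x → x ≤ A₁ → y ≤ A₂ → p₁ - p₂ ≤ x - y → H (x - y) ≤ g (x, y) :=
    fun x y h1 h2 h3 h4 => diagonal_le_sub_postedUtility hu h1 h2 h3 h4
  have hgK : ∀ x y, p₂ ≤ y → y ≤ A₂ → x ≤ A₁ → p₂ - p₁ ≤ y - x → K (y - x) ≤ g (x, y) := by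
    intro x y h1 h2 h3 h4
    have := diagonal_le_sub_postedUtility (u := fun z => u z.swap) hu' h1 h2 h3 h4
    simp_rw [← postedUtility_swap p₁ p₂] at this
    exact this
  have hg0 : ∀ x y, a₁ ≤ x → x ≤ p₁ → a₂ ≤ y → y ≤ p₂ → 0 ≤ g (x, y) := by
    intro x y h1 h2 h3 h4
    have h5 : postedUtility p₁ p₂ (x, y) = 0 :=
      max_eq_left (max_le (by dsimp only; linarith) (by dsimp only; linarith))
    have h6 := hu0 (x, y) ⟨⟨h1, h2.trans hpA₁⟩, h3, h4.trans hpA₂⟩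
    simp only [hg, h5]; linarith
  have hsec1 : ∀ y, Continuous fun x => g (x, y) := fun y => by fun_prop
  have hsec2 : ∀ x, Continuous fun y => g (x, y) := fun x => by fun_prop
  have right : ∫ y in a₂..A₂, g (A₁, y) = ∫ v in A₁ - A₂..A₁ - a₂, H v := by
    rw [← intervalIntegral.integral_comp_sub_left]
    refine intervalIntegral.integral_congr fun y hy => ?_
    rw [uIcc_of_le (by linarith)] at hy
    simp only [H]
    rw [min_eq_left (by linarith [hy.2])]
    simp
  have top : ∫ x in a₁..A₁, g (x, A₂) =
      (∫ v in p₂ - p₁..A₂ - a₁, K v) + ∫ v in p₁ - p₂..A₁ - A₂, H v := by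
    rw [← intervalIntegral.integral_add_adjacent_intervals (b := p₁ - p₂ + A₂)
      ((hsec1 A₂).intervalIntegrable _ _) ((hsec1 A₂).intervalIntegrable _ _)]
    congr 1
    · have e : p₂ - p₁ = A₂ - (p₁ - p₂ + A₂) := by ring
      rw [e, ← intervalIntegral.integral_comp_sub_left]
      refine intervalIntegral.integral_congr fun x hx => ?_
      rw [uIcc_of_le (by linarith)] at hx
      simp only [K]
      rw [min_eq_left (by linarith [hx.2])]
      simp
    · have e : p₁ - p₂ = p₁ - p₂ + A₂ - A₂ := by ring
      conv_rhs => rw [e]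
      rw [← intervalIntegral.integral_comp_sub_right]
      refine intervalIntegral.integral_congr fun x hx => ?_
      rw [uIcc_of_le (by linarith)] at hx
      simp only [H]
      rw [min_eq_right (by linarith [hx.2])]
      simp
  have bottom : ∫ v in p₁ - a₂..A₁ - a₂, H v ≤ ∫ x in a₁..A₁, g (x, a₂) := by
    rw [← intervalIntegral.integral_add_adjacent_intervals (a := a₁) (b := p₁)
      ((hsec1 a₂).intervalIntegrable _ _) ((hsec1 a₂).intervalIntegrable _ _)]
    have h1 : 0 ≤ ∫ x in a₁..p₁, g (x, a₂) :=
      intervalIntegral.integral_nonneg hap₁ fun x hx => hg0 x a₂ hx.1 hx.2 le_rfl hap₂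
    have h2 : ∫ v in p₁ - a₂..A₁ - a₂, H v ≤ ∫ x in p₁..A₁, g (x, a₂) := by
      rw [← intervalIntegral.integral_comp_sub_right]
      exact intervalIntegral.integral_mono_on hpA₁
        (Continuous.intervalIntegrable (by fun_prop) _ _) ((hsec1 a₂).intervalIntegrable _ _)
        fun x hx => hgH x a₂ hx.1 hx.2 (by linarith) (by linarith [hx.1])
    linarith
  have left : ∫ v in p₂ - a₁..A₂ - a₁, K v ≤ ∫ y in a₂..A₂, g (a₁, y) := by
    rw [← intervalIntegral.integral_add_adjacent_intervals (a := a₂) (b := p₂)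
      ((hsec2 a₁).intervalIntegrable _ _) ((hsec2 a₁).intervalIntegrable _ _)]
    have h1 : 0 ≤ ∫ y in a₂..p₂, g (a₁, y) :=
      intervalIntegral.integral_nonneg hap₂ fun y hy => hg0 a₁ y le_rfl hap₁ hy.1 hy.2
    have h2 : ∫ v in p₂ - a₁..A₂ - a₁, K v ≤ ∫ y in p₂..A₂, g (a₁, y) := by
      rw [← intervalIntegral.integral_comp_sub_right]
      exact intervalIntegral.integral_mono_on hpA₂
        (Continuous.intervalIntegrable (by fun_prop) _ _) ((hsec2 a₁).intervalIntegrable _ _)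
        fun y hy => hgK a₁ y hy.1 hy.2 (by linarith) (by linarith [hy.1])
    linarith
  have bulk : (∫ v in p₁ - p₂..A₁ - a₂, H v * diagLength A₁ a₂ A₂ p₁ v) +
      (∫ v in p₂ - p₁..A₂ - a₁, K v * diagLength A₂ a₁ A₁ p₂ v) ≤
      ∫ z in Icc a₁ A₁ ×ˢ Icc a₂ A₂, g z := by
    let A : Set (ℝ × ℝ) := {z | z.1 ∈ Icc p₁ A₁ ∧ z.2 ∈ Icc a₂ A₂ ∧ z.1 - z.2 ∈ Ici (p₁ - p₂)}
    -- The item-2 region with coordinates swapped, so that the same shear formula applies; the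
    -- strict inequality makes B disjoint from A.
    let B' : Set (ℝ × ℝ) := {z | z.1 ∈ Icc p₂ A₂ ∧ z.2 ∈ Icc a₁ A₁ ∧ z.1 - z.2 ∈ Ioi (p₂ - p₁)}
    let B : Set (ℝ × ℝ) := Prod.swap ⁻¹' B'
    have hA : MeasurableSet A :=
      (measurableSet_Icc.preimage measurable_fst).inter ((measurableSet_Icc.preimage
        measurable_snd).inter (measurableSet_Ici.preimage (measurable_fst.sub measurable_snd)))
    have hB' : MeasurableSet B' :=
      (measurableSet_Icc.preimage measurable_fst).inter ((measurableSet_Icc.preimage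
        measurable_snd).inter (measurableSet_Ioi.preimage (measurable_fst.sub measurable_snd)))
    have hB : MeasurableSet B := hB'.preimage measurable_swap
    have hD : MeasurableSet (Icc a₁ A₁ ×ˢ Icc a₂ A₂) := measurableSet_Icc.prod measurableSet_Icc
    have hAD : A ⊆ Icc a₁ A₁ ×ˢ Icc a₂ A₂ :=
      fun z hz => ⟨⟨hap₁.trans hz.1.1, hz.1.2⟩, hz.2.1⟩
    have hBD : B ⊆ Icc a₁ A₁ ×ˢ Icc a₂ A₂ :=
      fun z hz => ⟨hz.2.1, ⟨hap₂.trans hz.1.1, hz.1.2⟩⟩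
    have hcomp : IsCompact (Icc a₁ A₁ ×ˢ Icc a₂ A₂) := isCompact_Icc.prod isCompact_Icc
    have iH : IntegrableOn (fun z : ℝ × ℝ => H (z.1 - z.2)) (Icc a₁ A₁ ×ˢ Icc a₂ A₂) :=
      ContinuousOn.integrableOn_compact hcomp (by fun_prop)
    have iK : IntegrableOn (fun z : ℝ × ℝ => K (z.2 - z.1)) (Icc a₁ A₁ ×ˢ Icc a₂ A₂) :=
      ContinuousOn.integrableOn_compact hcomp (by fun_prop)
    have eA : ∫ v in p₁ - p₂..A₁ - a₂, H v * diagLength A₁ a₂ A₂ p₁ v =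
        ∫ z in Icc a₁ A₁ ×ˢ Icc a₂ A₂, A.indicator (fun z => H (z.1 - z.2)) z := by
      rw [setIntegral_indicator hA, inter_eq_right.2 hAD,
        setIntegral_comp_fst_sub_snd hHc measurableSet_Ici, integral_Ici_eq_integral_Ioi,
        setIntegral_Ioi_mul_diagLength hpA₁ (by linarith) (by linarith) (by linarith)]
    have eB : ∫ v in p₂ - p₁..A₂ - a₁, K v * diagLength A₂ a₁ A₁ p₂ v =
        ∫ z in Icc a₁ A₁ ×ˢ Icc a₂ A₂, B.indicator (fun z => K (z.2 - z.1)) z := by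
      have hswap := (Measure.measurePreserving_swap (μ := (volume : Measure ℝ))
        (ν := (volume : Measure ℝ))).setIntegral_preimage_emb
        MeasurableEquiv.prodComm.measurableEmbedding (fun z => K (z.1 - z.2)) B'
      rw [setIntegral_indicator hB, inter_eq_right.2 hBD]
      refine Eq.trans ?_ hswap.symm
      exact ((setIntegral_comp_fst_sub_snd hKc measurableSet_Ioi _ _ _ _).trans
        (setIntegral_Ioi_mul_diagLength hpA₂ (by linarith) (by linarith) (by linarith))).symm
    rw [eA, eB, ← integral_add (iH.indicator hA) (iK.indicator hB)]
    refine setIntegral_mono_on ((iH.indicator hA).add (iK.indicator hB))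
      (hgc.continuousOn.integrableOn_compact hcomp) hD fun z hz => ?_
    by_cases hzA : z ∈ A
    · have hzB : z ∉ B := fun h => by
        have h1 : p₁ - p₂ ≤ z.1 - z.2 := hzA.2.2
        have h2 : p₂ - p₁ < z.2 - z.1 := h.2.2
        linarith
      rw [indicator_of_mem hzA, indicator_of_notMem hzB, add_zero]
      exact hgH z.1 z.2 hzA.1.1 hzA.1.2 hzA.2.1.2 hzA.2.2
    · rw [indicator_of_notMem hzA, zero_add]
      by_cases hzB : z ∈ B
      · rw [indicator_of_mem hzB]
        exact hgK z.1 z.2 hzB.1.1 hzB.1.2 hzB.2.1.2 (le_of_lt hzB.2.2)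
      · rw [indicator_of_notMem hzB]
        have h1 : z.1 ≤ p₁ := by
          by_contra! h
          by_cases h' : p₁ - p₂ ≤ z.1 - z.2
          · exact hzA ⟨⟨h.le, hz.1.2⟩, hz.2, h'⟩
          · exact hzB ⟨⟨show p₂ ≤ z.2 by linarith, hz.2.2⟩, hz.1,
              show p₂ - p₁ < z.2 - z.1 by linarith⟩
        have h2 : z.2 ≤ p₂ := by
          by_contra! h
          exact hzB ⟨⟨h.le, hz.2.2⟩, hz.1, show p₂ - p₁ < z.2 - z.1 by linarith⟩
        exact hg0 z.1 z.2 hz.1.1 h1 hz.2.1 h2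
  have dR := diagonal_dominance_right hHc hH ha₂ hap₂ hpA₂ hpA₁ hpp hslope haA hright
  have dT := diagonal_dominance_top (A₁ := A₁) hKc hK hap₁ hpA₂ ha (by linarith) hslope htop
  have b1 := mul_le_mul_of_nonneg_left bottom ha₂
  have b2 := mul_le_mul_of_nonneg_left left ha₁
  rw [revenueFunctional, right, top]
  linarith

/-! ### Integration by parts for Lipschitz functions -/

/-- Slices of f are Lipschitz, hence absolutely continuous, so integration by parts holds on each;
Fubini assembles the slices because the derivative is measurable and bounded by C. -/
theorem setIntegral_fst_mul_deriv {f : ℝ × ℝ → ℝ} {C : NNReal} (hf : LipschitzWith C f)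
    {a₁ A₁ a₂ A₂ : ℝ} (h₁ : a₁ ≤ A₁) (h₂ : a₂ ≤ A₂) :
    IntegrableOn (fun z : ℝ × ℝ => z.1 * deriv (fun x => f (x, z.2)) z.1)
      (Icc a₁ A₁ ×ˢ Icc a₂ A₂) ∧
    ∫ z in Icc a₁ A₁ ×ˢ Icc a₂ A₂, z.1 * deriv (fun x => f (x, z.2)) z.1 =
      A₁ * (∫ y in a₂..A₂, f (A₁, y)) - a₁ * (∫ y in a₂..A₂, f (a₁, y))
        - ∫ z in Icc a₁ A₁ ×ˢ Icc a₂ A₂, f z := by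
  have hcomp : IsCompact (Icc a₁ A₁ ×ˢ Icc a₂ A₂) := isCompact_Icc.prod isCompact_Icc
  have hfc := hf.continuous
  have hslice : ∀ y, LipschitzWith C fun x => f (x, y) := fun y => by
    simpa [Function.comp_def] using hf.comp (LipschitzWith.prodMk_right y)
  have hmeas : Measurable fun z : ℝ × ℝ => deriv (fun x => f (x, z.2)) z.1 :=
    (measurable_deriv_with_param (f := fun y x => f (x, y))
      (by simp only [Function.uncurry_def]; fun_prop)).comp measurable_swap
  have hint : IntegrableOn (fun z : ℝ × ℝ => z.1 * deriv (fun x => f (x, z.2)) z.1)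
      (Icc a₁ A₁ ×ˢ Icc a₂ A₂) :=
    (continuous_fst.continuousOn.integrableOn_compact hcomp).mul_bdd
      (c := C) hmeas.aestronglyMeasurable
      (ae_of_all _ fun z => norm_deriv_le_of_lipschitz (hslice z.2))
  have hfint : IntegrableOn f (Icc a₁ A₁ ×ˢ Icc a₂ A₂) :=
    hfc.continuousOn.integrableOn_compact hcomp
  refine ⟨hint, ?_⟩
  have hparts : ∀ y, ∫ x in a₁..A₁, x * deriv (fun x => f (x, y)) x =
      A₁ * f (A₁, y) - a₁ * f (a₁, y) - ∫ x in a₁..A₁, f (x, y) := by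
    intro y
    have hid : AbsolutelyContinuousOnInterval (fun x : ℝ => x) a₁ A₁ :=
      (LipschitzWith.id.lipschitzOnWith).absolutelyContinuousOnInterval
    have := hid.integral_mul_deriv_eq_deriv_mul
      ((hslice y).lipschitzOnWith.absolutelyContinuousOnInterval)
    simpa using this
  have hfub : ∀ F : ℝ × ℝ → ℝ, IntegrableOn F (Icc a₁ A₁ ×ˢ Icc a₂ A₂) →
      ∫ z in Icc a₁ A₁ ×ˢ Icc a₂ A₂, F z = ∫ y in a₂..A₂, ∫ x in a₁..A₁, F (x, y) := by
    intro F hF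
    rw [IntegrableOn, Measure.volume_eq_prod, ← Measure.prod_restrict] at hF
    rw [Measure.volume_eq_prod, ← Measure.prod_restrict, integral_prod_symm _ hF,
      intervalIntegral.integral_of_le h₂, ← integral_Icc_eq_integral_Ioc]
    simp_rw [intervalIntegral.integral_of_le h₁, integral_Icc_eq_integral_Ioc]
  rw [hfub _ hint, hfub _ hfint]
  simp_rw [hparts]
  rw [intervalIntegral.integral_sub, intervalIntegral.integral_sub,
    intervalIntegral.integral_const_mul, intervalIntegral.integral_const_mul]
  · exact Continuous.intervalIntegrable (by fun_prop) _ _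
  · exact Continuous.intervalIntegrable (by fun_prop) _ _
  · exact Continuous.intervalIntegrable (by fun_prop) _ _
  · refine Continuous.intervalIntegrable ?_ _ _
    exact intervalIntegral.continuous_parametric_intervalIntegral_of_continuous'
      (by simp only [Function.uncurry_def]; fun_prop) _ _

theorem setIntegral_snd_mul_deriv {f : ℝ × ℝ → ℝ} {C : NNReal} (hf : LipschitzWith C f)
    {a₁ A₁ a₂ A₂ : ℝ} (h₁ : a₁ ≤ A₁) (h₂ : a₂ ≤ A₂) :
    IntegrableOn (fun z : ℝ × ℝ => z.2 * deriv (fun y => f (z.1, y)) z.2)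
      (Icc a₁ A₁ ×ˢ Icc a₂ A₂) ∧
    ∫ z in Icc a₁ A₁ ×ˢ Icc a₂ A₂, z.2 * deriv (fun y => f (z.1, y)) z.2 =
      A₂ * (∫ x in a₁..A₁, f (x, A₂)) - a₂ * (∫ x in a₁..A₁, f (x, a₂))
        - ∫ z in Icc a₁ A₁ ×ˢ Icc a₂ A₂, f z := by
  have hfs : LipschitzWith C fun z : ℝ × ℝ => f z.swap := by
    refine LipschitzWith.of_dist_le_mul fun z w => (hf.dist_le_mul _ _).trans_eq ?_
    simp only [Prod.dist_eq, Prod.fst_swap, Prod.snd_swap]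
    rw [max_comm]
  obtain ⟨hi, he⟩ := setIntegral_fst_mul_deriv hfs h₂ h₁
  constructor
  · exact ((Measure.measurePreserving_swap (μ := (volume : Measure ℝ))
      (ν := (volume : Measure ℝ))).integrableOn_comp_preimage
      MeasurableEquiv.prodComm.measurableEmbedding (s := Icc a₂ A₂ ×ˢ Icc a₁ A₁)).2 hi |>.mono_set
      fun z hz => ⟨hz.2, hz.1⟩
  · rw [Measure.volume_eq_prod, ← setIntegral_prod_swap, ← setIntegral_prod_swap _ _ f]
    exact he

theorem revenueFunctional_congr {a₁ A₁ a₂ A₂ : ℝ} (h₁ : a₁ ≤ A₁) (h₂ : a₂ ≤ A₂)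
    {u v : ℝ × ℝ → ℝ} (huv : EqOn u v (Icc a₁ A₁ ×ˢ Icc a₂ A₂)) :
    revenueFunctional a₁ A₁ a₂ A₂ u = revenueFunctional a₁ A₁ a₂ A₂ v := by
  have hy : ∀ x ∈ Icc a₁ A₁, ∫ y in a₂..A₂, u (x, y) = ∫ y in a₂..A₂, v (x, y) := by
    intro x hx
    refine intervalIntegral.integral_congr fun y hy => huv ⟨hx, ?_⟩
    rwa [uIcc_of_le h₂] at hy
  have hx : ∀ y ∈ Icc a₂ A₂, ∫ x in a₁..A₁, u (x, y) = ∫ x in a₁..A₁, v (x, y) := by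
    intro y hy
    refine intervalIntegral.integral_congr fun x hx => huv ⟨?_, hy⟩
    rwa [uIcc_of_le h₁] at hx
  rw [revenueFunctional, revenueFunctional, hy _ (left_mem_Icc.2 h₁), hy _ (right_mem_Icc.2 h₁),
    hx _ (left_mem_Icc.2 h₂), hx _ (right_mem_Icc.2 h₂),
    setIntegral_congr_fun (measurableSet_Icc.prod measurableSet_Icc) huv]

/-- The coordinatewise projection onto the rectangle `[a₁, A₁] × [a₂, A₂]`. -/
def clampRect (a₁ A₁ a₂ A₂ : ℝ) (z : ℝ × ℝ) : ℝ × ℝ :=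
  (max a₁ (min A₁ z.1), max a₂ (min A₂ z.2))

theorem clampRect_mem {a₁ A₁ a₂ A₂ : ℝ} (h₁ : a₁ ≤ A₁) (h₂ : a₂ ≤ A₂) (z : ℝ × ℝ) :
    clampRect a₁ A₁ a₂ A₂ z ∈ Icc a₁ A₁ ×ˢ Icc a₂ A₂ :=
  ⟨⟨le_max_left _ _, max_le h₁ (min_le_left _ _)⟩, le_max_left _ _, max_le h₂ (min_le_left _ _)⟩

theorem clampRect_of_mem {a₁ A₁ a₂ A₂ : ℝ} {z : ℝ × ℝ} (hz : z ∈ Icc a₁ A₁ ×ˢ Icc a₂ A₂) :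
    clampRect a₁ A₁ a₂ A₂ z = z := by
  obtain ⟨⟨h1, h2⟩, h3, h4⟩ := hz
  simp [clampRect, h1, h2, h3, h4]

/-- Clamping is monotone and 1-Lipschitz, so the one-sided increment bound on utilities survives
extension to the plane. -/
theorem max_min_sub_max_min_le (a A x y : ℝ) :
    max a (min A y) - max a (min A x) ≤ max 0 (y - x) := by
  rw [sub_le_iff_le_add]
  have h0 := le_max_left 0 (y - x)
  have h1 := le_max_right 0 (y - x)
  have h2 := le_max_left a (min A x)
  have h3 := le_max_right a (min A x)
  refine max_le (by linarith) ?_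
  rcases min_choice A x with h | h
  · linarith [min_le_left A y]
  · linarith [min_le_right A y]

/-! ### Utility and revenue of feasible mechanisms -/

namespace Mechanism

/-- If z reports w, incentive compatibility bounds the difference by (w − z)·q(w), and q(w) has
nonnegative entries with sum at most 1. -/
theorem IsFeasible.utility_sub_le {M : Mechanism} {D : Set (ℝ × ℝ)} (hM : M.IsFeasible D)
    {z w : ℝ × ℝ} (hz : z ∈ D) (hw : w ∈ D) :
    M.utility w w - M.utility z z ≤ max 0 (max (w.1 - z.1) (w.2 - z.2)) := by
  obtain ⟨q1, q2, q3, -⟩ := hM.1 w hw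
  have hic := hM.2.1 z hz w hw
  set m := max 0 (max (w.1 - z.1) (w.2 - z.2))
  have m0 : 0 ≤ m := le_max_left _ _
  have m1 : w.1 - z.1 ≤ m := (le_max_left _ _).trans (le_max_right _ _)
  have m2 : w.2 - z.2 ≤ m := (le_max_right _ _).trans (le_max_right _ _)
  have e : M.utility w w - M.utility z w = (w.1 - z.1) * M.q₁ w + (w.2 - z.2) * M.q₂ w := by
    simp only [utility]; ring
  have i1 := mul_le_mul_of_nonneg_right m1 q1
  have i2 := mul_le_mul_of_nonneg_right m2 q2
  have i3 := mul_le_mul_of_nonneg_left q3 m0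
  linarith

/-- The truthful utility, extended from the rectangle to the plane. -/
def extendedUtility (M : Mechanism) (a₁ A₁ a₂ A₂ : ℝ) (z : ℝ × ℝ) : ℝ :=
  M.utility (clampRect a₁ A₁ a₂ A₂ z) (clampRect a₁ A₁ a₂ A₂ z)

variable {M : Mechanism} {a₁ A₁ a₂ A₂ : ℝ}

theorem extendedUtility_of_mem {z : ℝ × ℝ} (hz : z ∈ Icc a₁ A₁ ×ˢ Icc a₂ A₂) :
    M.extendedUtility a₁ A₁ a₂ A₂ z = M.utility z z := by
  rw [extendedUtility, clampRect_of_mem hz]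

theorem IsFeasible.extendedUtility_sub_le (hM : M.IsFeasible (Icc a₁ A₁ ×ˢ Icc a₂ A₂))
    (h₁ : a₁ ≤ A₁) (h₂ : a₂ ≤ A₂) (z w : ℝ × ℝ) :
    M.extendedUtility a₁ A₁ a₂ A₂ w - M.extendedUtility a₁ A₁ a₂ A₂ z ≤
      max 0 (max (w.1 - z.1) (w.2 - z.2)) :=
  (hM.utility_sub_le (clampRect_mem h₁ h₂ z) (clampRect_mem h₁ h₂ w)).trans <|
    max_le (le_max_left _ _) <| max_le
      ((max_min_sub_max_min_le _ _ _ _).trans (max_le_max le_rfl (le_max_left _ _)))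
      ((max_min_sub_max_min_le _ _ _ _).trans (max_le_max le_rfl (le_max_right _ _)))

theorem IsFeasible.lipschitzWith_extendedUtility (hM : M.IsFeasible (Icc a₁ A₁ ×ˢ Icc a₂ A₂))
    (h₁ : a₁ ≤ A₁) (h₂ : a₂ ≤ A₂) : LipschitzWith 1 (M.extendedUtility a₁ A₁ a₂ A₂) := by
  refine LipschitzWith.of_le_add fun w z => ?_
  rw [← sub_le_iff_le_add']
  refine (hM.extendedUtility_sub_le h₁ h₂ z w).trans (max_le dist_nonneg ?_)
  rw [Prod.dist_eq, Real.dist_eq, Real.dist_eq]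
  exact max_le_max (le_abs_self _) (le_abs_self _)

/-- By Rademacher, U is differentiable almost everywhere, and there t = z·∇U − U. This also yields
the integrability of t, whose measurability is not assumed. -/
theorem IsFeasible.integrableOn_and_setIntegral_t (hM : M.IsFeasible (Icc a₁ A₁ ×ˢ Icc a₂ A₂))
    (h₁ : a₁ ≤ A₁) (h₂ : a₂ ≤ A₂) :
    IntegrableOn M.t (Icc a₁ A₁ ×ˢ Icc a₂ A₂) ∧ ∫ z in Icc a₁ A₁ ×ˢ Icc a₂ A₂, M.t z =
      revenueFunctional a₁ A₁ a₂ A₂ (M.extendedUtility a₁ A₁ a₂ A₂) := by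
  set U := M.extendedUtility a₁ A₁ a₂ A₂ with hU
  have hL : LipschitzWith 1 U := hM.lipschitzWith_extendedUtility h₁ h₂
  obtain ⟨i1, e1⟩ := setIntegral_fst_mul_deriv hL h₁ h₂
  obtain ⟨i2, e2⟩ := setIntegral_snd_mul_deriv hL h₁ h₂
  have i3 : IntegrableOn U (Icc a₁ A₁ ×ˢ Icc a₂ A₂) :=
    hL.continuous.continuousOn.integrableOn_compact (isCompact_Icc.prod isCompact_Icc)
  have hae : (fun z : ℝ × ℝ => z.1 * deriv (fun x => U (x, z.2)) z.1 +
      z.2 * deriv (fun y => U (z.1, y)) z.2 - U z)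
      =ᵐ[volume.restrict (Icc a₁ A₁ ×ˢ Icc a₂ A₂)] M.t := by
    -- The edges are null. At an interior z, incentive compatibility makes U(w) − w·q(z) minimal at
    -- w = z, so its partial derivatives vanish.
    have hres : (volume : Measure (ℝ × ℝ)).restrict (Icc a₁ A₁ ×ˢ Icc a₂ A₂) =
        volume.restrict (Ioo a₁ A₁ ×ˢ Ioo a₂ A₂) :=
      (Measure.restrict_congr_set (Measure.set_prod_ae_eq Ioo_ae_eq_Icc Ioo_ae_eq_Icc)).symm
    rw [hres, Filter.EventuallyEq, ae_restrict_iff' (measurableSet_Ioo.prod measurableSet_Ioo)]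
    filter_upwards [hL.ae_differentiableAt] with z hd hz
    have hzD : z ∈ Icc a₁ A₁ ×ˢ Icc a₂ A₂ :=
      ⟨Ioo_subset_Icc_self hz.1, Ioo_subset_Icc_self hz.2⟩
    have hUz : U z = z.1 * M.q₁ z + z.2 * M.q₂ z - M.t z := extendedUtility_of_mem hzD
    have d1 : deriv (fun x => U (x, z.2)) z.1 = M.q₁ z := by
      have hdiff : DifferentiableAt ℝ (fun x => U (x, z.2)) z.1 :=
        DifferentiableAt.comp (g := U) z.1 hd (by fun_prop)
      have hmin : IsLocalMin (fun x => U (x, z.2) - x * M.q₁ z) z.1 := by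
        filter_upwards [Ioo_mem_nhds hz.1.1 hz.1.2] with x hx
        have hxD : (x, z.2) ∈ Icc a₁ A₁ ×ˢ Icc a₂ A₂ := ⟨Ioo_subset_Icc_self hx, hzD.2⟩
        have h3 : M.utility (x, z.2) z ≤ U (x, z.2) :=
          (hM.2.1 _ hxD z hzD).trans_eq (extendedUtility_of_mem hxD).symm
        simp only [utility] at h3
        rw [Prod.mk.eta, hUz]
        linarith
      have := hmin.hasDerivAt_eq_zero
        (hdiff.hasDerivAt.sub ((hasDerivAt_id z.1).mul_const (M.q₁ z)))
      linarith
    have d2 : deriv (fun y => U (z.1, y)) z.2 = M.q₂ z := by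
      have hdiff : DifferentiableAt ℝ (fun y => U (z.1, y)) z.2 :=
        DifferentiableAt.comp (g := U) z.2 hd (by fun_prop)
      have hmin : IsLocalMin (fun y => U (z.1, y) - y * M.q₂ z) z.2 := by
        filter_upwards [Ioo_mem_nhds hz.2.1 hz.2.2] with y hy
        have hyD : (z.1, y) ∈ Icc a₁ A₁ ×ˢ Icc a₂ A₂ := ⟨hzD.1, Ioo_subset_Icc_self hy⟩
        have h3 : M.utility (z.1, y) z ≤ U (z.1, y) :=
          (hM.2.1 _ hyD z hzD).trans_eq (extendedUtility_of_mem hyD).symm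
        simp only [utility] at h3
        rw [Prod.mk.eta, hUz]
        linarith
      have := hmin.hasDerivAt_eq_zero
        (hdiff.hasDerivAt.sub ((hasDerivAt_id z.2).mul_const (M.q₂ z)))
      linarith
    rw [d1, d2, hUz]; ring
  have i12 : IntegrableOn (fun z : ℝ × ℝ => z.1 * deriv (fun x => U (x, z.2)) z.1 +
      z.2 * deriv (fun y => U (z.1, y)) z.2) (Icc a₁ A₁ ×ˢ Icc a₂ A₂) := i1.add i2
  refine ⟨(i12.sub i3).congr hae, ?_⟩
  rw [← integral_congr_ae hae, integral_sub i12 i3, integral_add i1 i2, e1, e2,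
    revenueFunctional]
  ring

theorem utility_postedPrice (p₁ p₂ : ℝ) (z : ℝ × ℝ) :
    (postedPrice p₁ p₂).utility z z = postedUtility p₁ p₂ z := by
  simp only [utility, postedPrice, postedUtility]
  by_cases h1 : p₁ ≤ z.1 ∧ z.2 - p₂ ≤ z.1 - p₁
  · have h2 : ¬(p₂ ≤ z.2 ∧ z.1 - p₁ < z.2 - p₂) := fun h => by linarith [h.2, h1.2]
    rw [if_pos h1, if_neg h2, if_pos h1, max_eq_left h1.2, max_eq_right (by linarith [h1.1])]
    ring
  · by_cases h2 : p₂ ≤ z.2 ∧ z.1 - p₁ < z.2 - p₂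
    · rw [if_neg h1, if_pos h2, if_neg h1, if_pos h2, max_eq_right h2.2.le,
        max_eq_right (by linarith [h2.1])]
      ring
    · rw [if_neg h1, if_neg h2, if_neg h1, if_neg h2, max_eq_left]
      · ring
      · rcases le_or_gt (z.2 - p₂) (z.1 - p₁) with h | h
        · have : z.1 < p₁ := by
            by_contra! h'; exact h1 ⟨h', h⟩
          exact max_le (by linarith) (by linarith)
        · have : z.2 < p₂ := by
            by_contra! h'; exact h2 ⟨h', h⟩
          exact max_le (by linarith) (by linarith)

theorem isFeasible_postedPrice {p₁ p₂ : ℝ} (hp₁ : 0 ≤ p₁) (hp₂ : 0 ≤ p₂) (D : Set (ℝ × ℝ)) :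
    (postedPrice p₁ p₂).IsFeasible D := by
  refine ⟨fun z _ => ?_, fun z _ w _ => ?_, fun z _ => ?_⟩
  · simp only [postedPrice]
    split_ifs with h1 h2 <;> norm_num <;>
      first | assumption | exact absurd h1.2 (by linarith [h2.2])
  · rw [utility_postedPrice]
    have m0 : 0 ≤ postedUtility p₁ p₂ z := le_max_left _ _
    have m1 : z.1 - p₁ ≤ postedUtility p₁ p₂ z := (le_max_left _ _).trans (le_max_right _ _)
    have m2 : z.2 - p₂ ≤ postedUtility p₁ p₂ z := (le_max_right _ _).trans (le_max_right _ _)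
    simp only [utility, postedPrice]
    split_ifs with h1 h2
    · exact absurd h1.2 (by linarith [h2.2])
    all_goals linarith
  · rw [utility_postedPrice]; exact le_max_left _ _

theorem revenue_eq_inv_mul (M : Mechanism) (D : Set (ℝ × ℝ)) :
    M.revenue D = ((volume D)⁻¹).toReal * ∫ z in D, M.t z := by
  rw [revenue, uniformDist, ProbabilityTheory.cond, integral_smul_measure, smul_eq_mul]

end Mechanism

/-! ### Optimality of the posted prices -/

theorem theorem10 (c₁ c₂ b₁ b₂ : ℝ) (hb₂ : 0 < b₂) (hb : b₂ ≤ b₁)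
    (hc₂ : 0 ≤ c₂) (hc : c₂ ≤ c₁) (h : 2 * c₁ - c₂ ≤ b₂) :
    (∃ δ₁ δ₂ : ℝ, IsPriceSolution c₁ c₂ b₁ b₂ δ₁ δ₂) ∧
    ∀ δ₁ δ₂ : ℝ, IsPriceSolution c₁ c₂ b₁ b₂ δ₁ δ₂ →
      δ₁ - δ₂ ≤ b₁ - b₂ ∧
      (Mechanism.postedPrice (c₁ + δ₁) (c₂ + δ₂)).IsOptimal (valuationRect c₁ c₂ b₁ b₂) := by
  refine ⟨exists_isPriceSolution hb₂ hb hc₂ hc h, fun δ₁ δ₂ hs => ?_⟩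
  have hsub := hs.sub_le_sub hb hc₂ hc h
  obtain ⟨hslope, -⟩ := hs.slope_bounds h
  obtain ⟨⟨h1, h1'⟩, ⟨h2, h2'⟩, e1, e2⟩ := hs
  have hr₁ : c₁ ≤ c₁ + b₁ := by linarith
  have hr₂ : c₂ ≤ c₂ + b₂ := by linarith
  have hfeas := Mechanism.isFeasible_postedPrice (p₁ := c₁ + δ₁) (p₂ := c₂ + δ₂) (by linarith)
    (by linarith) (valuationRect c₁ c₂ b₁ b₂)
  obtain ⟨hint, hrev⟩ := hfeas.integrableOn_and_setIntegral_t hr₁ hr₂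
  have hvol : volume (valuationRect c₁ c₂ b₁ b₂) ≠ 0 := by
    rw [valuationRect, Measure.volume_eq_prod, Measure.prod_prod, Real.volume_Icc, Real.volume_Icc]
    simp [hb₂, hb₂.trans_le hb]
  refine ⟨hsub, hfeas, hint.smul_measure (ENNReal.inv_ne_top.2 hvol), fun M hM => ?_⟩
  obtain ⟨-, hrevM⟩ := hM.integrableOn_and_setIntegral_t hr₁ hr₂
  rw [Mechanism.revenue_eq_inv_mul, Mechanism.revenue_eq_inv_mul]
  refine mul_le_mul_of_nonneg_left ?_ ENNReal.toReal_nonneg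
  refine hrevM.trans_le (le_trans ?_ hrev.ge)
  rw [revenueFunctional_congr hr₁ hr₂ (v := postedUtility (c₁ + δ₁) (c₂ + δ₂))
    (u := (Mechanism.postedPrice _ _).extendedUtility _ _ _ _) fun z hz =>
      (Mechanism.extendedUtility_of_mem hz).trans (Mechanism.utility_postedPrice _ _ z)]
  -- The second price equation is the zero-mass condition of the item-2 region; minus the sum of the
  -- two equations is that of the item-1 region.
  refine revenueFunctional_le_postedUtility (hM.lipschitzWith_extendedUtility hr₁ hr₂).continuous
    (hc₂.trans hc) hc₂ (by linarith) (by linarith) (by linarith) (by linarith)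
    (hM.extendedUtility_sub_le hr₁ hr₂) (fun z hz => ?_) (by linarith) (by linarith) (by linarith)
    (by linarith) (by linear_combination -e1 - e2) (by linear_combination e2)
  rw [Mechanism.extendedUtility_of_mem hz]
  exact hM.2.2 z hz
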